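/- Let $(X,\mathcal{B},m)$ be a non-atomic probability space and $\tau:X\to X$ an invertible (bimeasurable), measure-preserving, ergodic transformation. For $n\ge 1$ let $a_n\in[0,1]$, let $x_n$ be an integer with $|x_n|\ge 1$, let $\gamma_n$ be a probability measure on $\mathbb{Z}$, and put $\nu_n=a_n\delta_{x_n}+(1-a_n)\gamma_n$. Assume that $\sum_{n}(1-a_n)<\infty$ and that the partial sums $\sum_{n=1}^N x_n$ tend to $+\infty$ or tend to $-\infty$ as $N\to\infty$. Let $\mu_n=\nu_1*\nu_2*\cdots*\nu_n$ and $\mu_n f(x)=\sum_{k\in\mathbb{Z}}\mu_n(k)f(\tau^k x)$. Then the sequence $(\mu_n)$ has the strong sweeping out property in $(X,\mathcal{B},m,\tau)$: for every $\varepsilon>0$ there is a set $B\in\mathcal{B}$ with $m(B)<\varepsilon$ such that $$\limsup_{n\to\infty}\mu_n\chi_B(x)=1\ \text{ for a.e. } x\qquad\text{and}\qquad \liminf_{n\to\infty}\mu_n\chi_B(x)=0\ \text{ for a.e. } x.$$ -/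

import Mathlib

open Filter MeasureTheory Topology

/-- A measure is non-atomic if it has no atoms: every measurable set of positive measure has a
measurable subset of strictly smaller, positive measure. (In a general measurable space this is
stronger than the vanishing of the measure on singletons.) -/
def IsNonAtomic {X : Type*} [MeasurableSpace X] (m : Measure X) : Prop :=
  ∀ A : Set X, MeasurableSet A → 0 < m A →
    ∃ B : Set X, MeasurableSet B ∧ B ⊆ A ∧ 0 < m B ∧ m B < m A

/-- The convolution products `ν 0`, `ν 0 ∗ ν 1`, `ν 0 ∗ ν 1 ∗ ν 2`, ... of a sequence of measures
on `ℤ`; the term with index `n` is `ν 0 ∗ ν 1 ∗ ⋯ ∗ ν n`. -/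
noncomputable def convProd (ν : ℕ → Measure ℤ) : ℕ → Measure ℤ
  | 0 => ν 0
  | n + 1 => (convProd ν n).conv (ν (n + 1))

/-- The weighted average `μ f (x) = ∑ k, μ(k) f(τ^k x)` over `k ∈ ℤ`, for an invertible
bimeasurable `τ`. -/
noncomputable def weightedAverage {X : Type*} [MeasurableSpace X] (τ : X ≃ᵐ X) (μ : Measure ℤ)
    (f : X → ℝ) (x : X) : ℝ :=
  ∑' k : ℤ, μ.real {k} * f ((τ.toEquiv ^ k : Equiv.Perm X) x)

/-- The sequence `μ` of (probability) measures on `ℤ` is strong sweeping out for the system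
`(X, m, τ)`: for every `ε > 0` there is a measurable set `B` with `m B < ε` such that
`limsup μ_n χ_B = 1` and `liminf μ_n χ_B = 0` almost everywhere. -/
def StrongSweepingOut {X : Type*} [MeasurableSpace X] (m : Measure X) (τ : X ≃ᵐ X)
    (μ : ℕ → Measure ℤ) : Prop :=
  ∀ ε : ℝ, 0 < ε → ∃ B : Set X, MeasurableSet B ∧ m B < ENNReal.ofReal ε ∧
    (∀ᵐ x ∂m, limsup (fun n : ℕ =>
      weightedAverage τ (μ n) (B.indicator fun _ => (1 : ℝ)) x) atTop = 1) ∧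
    (∀ᵐ x ∂m, liminf (fun n : ℕ =>
      weightedAverage τ (μ n) (B.indicator fun _ => (1 : ℝ)) x) atTop = 0)

open Set
open scoped ENNReal

/-! ### A colouring of the integers adapted to a divergent sequence -/

/-! Write `s n` for the partial sums of `x`. As `1 - a n` is summable, all but `δ` of the mass of
the `n`-th product lies within a fixed distance of `s n`, for all large `n`
(`exists_convProd_concentration`). Hence it suffices to find a small `B` such that almost every
orbit has arbitrarily long windows around terms of `s` inside `B`, and others outside it
(`exists_small_set_windows`).

Small sets that are hit come from rotations: for a suitable `α`, the multiples `s n * α` visit all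
`L` arcs of the circle, so the colouring `⌊L * j * α⌋` mod `L` can be advanced by any amount, up to
one (`exists_colouring`). Non-atomicity and ergodicity carry it to `X`: the time since the last
visit to a tiny set acts as the coordinate `j` (`exists_equivariant_on_window`). Two adjacent
colours of total measure at most `2 / L` are then reached from most points
(`exists_small_swept_set`).

Thickening yields windows. Choosing the sets `D K` successively, each too small to disturb the
earlier stages, lets the parity of `K` decide between inside and outside. -/

theorem exists_Icc_mul_mem_arc {t : ℕ → ℤ} (ht : Tendsto t atTop atTop) (N : ℕ) {L : ℕ}
    (hL : 0 < L) (l : ℕ) :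
    ∃ u v : ℝ, u < v ∧ ∀ i < l, ∃ n ≥ N, ∀ α ∈ Icc u v,
      ∃ z : ℤ, (z * L + i : ℝ) ≤ L * (t n * α) ∧ (L * (t n * α) : ℝ) ≤ z * L + i + 1 := by
  induction l with
  | zero => exact ⟨0, 1, by norm_num, by simp⟩
  | succ l ih =>
    obtain ⟨u, v, huv, h⟩ := ih
    have hd : 0 < v - u := sub_pos.2 huv
    have htR : Tendsto (fun n => (t n : ℝ)) atTop atTop := tendsto_intCast_atTop_atTop.comp ht
    -- Multiplication by `t n` stretches `[u, v]` to length at least `l + 3`, enough to contain the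
    -- arc `[z + l/L, z + (l+1)/L]` with `z = ⌈t n * u⌉`. Its preimage is the next nested interval.
    obtain ⟨n, hn, hnN, hn1⟩ := ((htR.eventually_ge_atTop ((l + 3) / (v - u))).and
      ((eventually_ge_atTop N).and (htR.eventually_ge_atTop 1))).exists
    rw [div_le_iff₀ hd] at hn
    have hs : (0 : ℝ) < t n := by linarith
    have hL' : (1 : ℝ) ≤ L := by exact_mod_cast hL
    have hL0 : (0 : ℝ) < L := by linarith
    set s : ℝ := (t n : ℝ)
    set z : ℤ := ⌈s * u⌉
    have hz : s * u ≤ z := Int.le_ceil _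
    have hz' : (z : ℝ) < s * u + 1 := Int.ceil_lt_add_one _
    have hl : ((l : ℝ) + 1) / L ≤ l + 1 := div_le_self (by positivity) hL'
    have hl0 : (0 : ℝ) ≤ l / L := by positivity
    have hu : u ≤ (z + l / L) / s := by
      rw [le_div_iff₀ hs]; linarith
    have hv : (z + (l + 1) / L) / s ≤ v := by
      rw [div_le_iff₀ hs]; nlinarith
    refine ⟨(z + l / L) / s, (z + (l + 1) / L) / s, ?_, fun i hi => ?_⟩
    · gcongr; linarith
    · rcases Nat.lt_succ_iff_lt_or_eq.1 hi with hi | rfl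
      · obtain ⟨k, hk, hk'⟩ := h i hi
        exact ⟨k, hk, fun α hα => hk' α ⟨hu.trans hα.1, hα.2.trans hv⟩⟩
      · refine ⟨n, hnN, fun α hα => ⟨z, ?_, ?_⟩⟩
        · have := hα.1
          rw [div_le_iff₀ hs, mul_comm] at this
          calc (z * L + i : ℝ) = L * (z + i / L) := by field_simp
            _ ≤ L * (s * α) := by gcongr
        · have := hα.2
          rw [le_div_iff₀ hs, mul_comm] at this
          calc (L * (s * α) : ℝ) ≤ L * (z + (i + 1) / L) := by gcongr
            _ = _ := by field_simp; ring

/-- A slope all of whose multiples by suitable terms of `s` fall into prescribed arcs. -/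
theorem exists_mul_mem_arc {s : ℕ → ℤ} (hs : Tendsto s atTop atTop ∨ Tendsto s atTop atBot)
    (N : ℕ) {L : ℕ} (hL : 0 < L) :
    ∃ α : ℝ, ∀ i < L, ∃ n ≥ N, ∃ z : ℤ,
      (z * L + i : ℝ) ≤ L * (s n * α) ∧ (L * (s n * α) : ℝ) ≤ z * L + i + 1 := by
  rcases hs with hs | hs
  · obtain ⟨u, v, huv, h⟩ := exists_Icc_mul_mem_arc hs N hL L
    refine ⟨u, fun i hi => ?_⟩
    obtain ⟨n, hn, h⟩ := h i hi
    exact ⟨n, hn, h u ⟨le_rfl, huv.le⟩⟩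
  · obtain ⟨u, v, huv, h⟩ := exists_Icc_mul_mem_arc (tendsto_neg_atBot_atTop.comp hs) N hL L
    refine ⟨-u, fun i hi => ?_⟩
    obtain ⟨n, hn, h⟩ := h i hi
    refine ⟨n, hn, ?_⟩
    simpa using h u ⟨le_rfl, huv.le⟩

/-- A colouring of `ℤ` by `ZMod L` for which translation by a suitable term of `s` advances every
colour by any prescribed amount, up to an error of one. -/
theorem exists_colouring {s : ℕ → ℤ} (hs : Tendsto s atTop atTop ∨ Tendsto s atTop atBot)
    (N : ℕ) {L : ℕ} [NeZero L] :
    ∃ f : ℤ → ZMod L, ∀ i : ZMod L, ∃ n ≥ N, ∀ j : ℤ,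
      f (j + s n) = f j + i ∨ f (j + s n) = f j + i + 1 := by
  obtain ⟨α, h⟩ := exists_mul_mem_arc hs N (NeZero.pos L)
  refine ⟨fun j => (⌊(L * (j * α) : ℝ)⌋ : ℤ), fun i => ?_⟩
  obtain ⟨n, hn, z, hz, hz'⟩ := h i.val (ZMod.val_lt i)
  refine ⟨n, hn, fun j => ?_⟩
  have e : (L * (((j + s n : ℤ) : ℝ) * α) : ℝ) = L * (j * α) + L * (s n * α) := by
    push_cast; ring
  simp only [e]
  set b : ℝ := L * (j * α)
  set c : ℝ := L * (s n * α)
  have h1 := Int.floor_le b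
  have h2 := Int.lt_floor_add_one b
  -- The uncertainty of one comes from the fractional part of `b`; the term `z * L` vanishes in
  -- `ZMod L`.
  have lo : ⌊b⌋ + (z * L + i.val) ≤ ⌊b + c⌋ := by
    rw [Int.le_floor]; push_cast; linarith
  have hi : ⌊b + c⌋ < ⌊b⌋ + (z * L + i.val) + 2 := by
    rw [Int.floor_lt]; push_cast; linarith
  have : ⌊b + c⌋ = ⌊b⌋ + (z * L + i.val) ∨ ⌊b + c⌋ = ⌊b⌋ + (z * L + i.val) + 1 := by omega
  rcases this with h | h
  · left; rw [h]; simp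
  · right; rw [h]; simp

/-! ### Averages of indicators and concentration of convolution products -/

theorem weightedAverage_indicator {X : Type*} [MeasurableSpace X] (τ : X ≃ᵐ X) (μ : Measure ℤ)
    [IsFiniteMeasure μ] (B : Set X) (x : X) :
    weightedAverage τ μ (B.indicator fun _ => (1 : ℝ)) x =
      μ.real {k : ℤ | (τ.toEquiv ^ k : Equiv.Perm X) x ∈ B} := by
  set S := {k : ℤ | (τ.toEquiv ^ k : Equiv.Perm X) x ∈ B}
  have hS : MeasurableSet S := S.to_countable.measurableSet
  have h := integral_countable (μ := μ) (f := S.indicator fun _ => (1 : ℝ))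
    ((integrable_const _).indicator hS)
  rw [integral_indicator_const _ hS, smul_eq_mul, mul_one] at h
  rw [h]
  rfl

theorem isProbabilityMeasure_convProd {ν : ℕ → Measure ℤ} (hν : ∀ n, IsProbabilityMeasure (ν n))
    (n : ℕ) : IsProbabilityMeasure (convProd ν n) := by
  induction n with
  | zero => exact hν 0
  | succ n ih =>
    have := hν (n + 1)
    exact inferInstanceAs (IsProbabilityMeasure ((convProd ν n).conv (ν (n + 1))))

theorem mul_le_conv_real {μ ν : Measure ℤ} [IsProbabilityMeasure μ] [IsProbabilityMeasure ν]
    (S T : Set ℤ) (x : ℤ) (h : ∀ k ∈ S, k + x ∈ T) :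
    μ.real S * ν.real {x} ≤ (μ.conv ν).real T := by
  have hT : MeasurableSet T := T.to_countable.measurableSet
  rw [Measure.real, Measure.real, ← ENNReal.toReal_mul, ← Measure.prod_prod, Measure.real,
    Measure.conv, Measure.map_apply (by fun_prop) hT]
  refine ENNReal.toReal_mono (measure_ne_top _ _) (measure_mono ?_)
  rintro ⟨k, y⟩ ⟨hk, rfl⟩
  exact h k hk

theorem exists_centred_interval (μ : Measure ℤ) [IsProbabilityMeasure μ] (c : ℤ) {δ : ℝ}
    (hδ : 0 < δ) : ∃ K : ℕ, 1 - δ ≤ μ.real {k | |k - c| ≤ K} := by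
  have hmono : Monotone fun K : ℕ => {k : ℤ | |k - c| ≤ K} := fun a b hab k hk =>
    le_trans (show |k - c| ≤ a from hk) (by exact_mod_cast hab)
  have h := tendsto_measure_iUnion_atTop (μ := μ) hmono
  have hU : ⋃ K : ℕ, {k : ℤ | |k - c| ≤ K} = univ := by
    refine eq_univ_of_forall fun k => mem_iUnion.2 ⟨(k - c).natAbs, ?_⟩
    simp
  rw [hU, measure_univ] at h
  have h' := (ENNReal.tendsto_toReal ENNReal.one_ne_top).comp h
  obtain ⟨K, hK⟩ := (h'.eventually_const_le (u := 1 - δ) (by simpa using hδ)).exists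
  exact ⟨K, hK⟩

/-- If the `n`-th factor has mass at least `a n` at `x n`, and `1 - a n` is summable, the products
are tight around the partial sums of `x`. -/
theorem exists_convProd_concentration {a : ℕ → ℝ} {x : ℕ → ℤ} {ν : ℕ → Measure ℤ}
    (hν : ∀ n, IsProbabilityMeasure (ν n)) (hle : ∀ n, a n ≤ 1)
    (ha : ∀ n, a n ≤ (ν n).real {x n})
    (hsum : Summable fun n => 1 - a n) {δ : ℝ} (hδ : 0 < δ) :
    ∃ K N : ℕ, ∀ n ≥ N,
      1 - δ ≤ (convProd ν n).real {k | |k - ∑ i ∈ Finset.range (n + 1), x i| ≤ K} := by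
  have := isProbabilityMeasure_convProd hν
  have hnn : ∀ n, 0 ≤ 1 - a n := fun n => sub_nonneg.2 (hle n)
  obtain ⟨N, hN⟩ := ((tendsto_sum_nat_add fun n => 1 - a n).eventually_le_const
    (u := δ / 2) (by positivity)).exists
  obtain ⟨K, hK⟩ := exists_centred_interval (convProd ν N) (∑ i ∈ Finset.range (N + 1), x i)
    (half_pos hδ)
  refine ⟨K, N, fun n hn => ?_⟩
  obtain ⟨j, rfl⟩ := Nat.exists_eq_add_of_le hn
  -- The radius `K` never grows: the window moves along with `x`, and each new factor costs at most
  -- `1 - a`.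
  have key : 1 - δ / 2 - ∑ i ∈ Finset.range j, (1 - a (N + 1 + i)) ≤
      (convProd ν (N + j)).real {k | |k - ∑ i ∈ Finset.range (N + j + 1), x i| ≤ K} := by
    clear hn
    induction j with
    | zero => simpa using hK
    | succ j ih =>
      have h1 := mul_le_conv_real (μ := convProd ν (N + j)) (ν := ν (N + j + 1))
        {k | |k - ∑ i ∈ Finset.range (N + j + 1), x i| ≤ K}
        {k | |k - ∑ i ∈ Finset.range (N + (j + 1) + 1), x i| ≤ K} (x (N + j + 1)) (by
          intro k hk
          rw [mem_ofPred_eq, ← add_assoc, Finset.sum_range_succ _ (N + j + 1)]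
          convert (show |k - ∑ i ∈ Finset.range (N + j + 1), x i| ≤ K from hk) using 2
          ring)
      refine le_trans ?_ h1
      rw [Finset.sum_range_succ]
      have h2 := ha (N + j + 1)
      have h3 : (convProd ν (N + j)).real
        {k | |k - ∑ i ∈ Finset.range (N + j + 1), x i| ≤ K} ≤ 1 := measureReal_le_one
      have h4 : (0 : ℝ) ≤ (convProd ν (N + j)).real
        {k | |k - ∑ i ∈ Finset.range (N + j + 1), x i| ≤ K} := measureReal_nonneg
      have h5 := hnn (N + j + 1)
      rw [show N + 1 + j = N + j + 1 by ring]
      nlinarith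
  have h6 : ∑ i ∈ Finset.range j, (1 - a (N + 1 + i)) ≤ ∑' k, (1 - a (k + N)) := by
    have hs : Summable fun k => 1 - a (k + N) := (summable_nat_add_iff N).2 hsum
    calc _ ≤ ∑ i ∈ Finset.range (j + 1), (1 - a (i + N)) := by
          rw [Finset.sum_range_succ']
          have := hnn (0 + N)
          simp_rw [show ∀ i, i + 1 + N = N + 1 + i by intro i; ring]
          linarith
      _ ≤ _ := hs.sum_le_tsum _ fun i _ => hnn _
  linarith

theorem limsup_eq_one_of_frequently {u : ℕ → ℝ} (h0 : ∀ n, 0 ≤ u n) (h1 : ∀ n, u n ≤ 1)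
    (h : ∀ δ > 0, ∃ᶠ n in atTop, 1 - δ ≤ u n) : limsup u atTop = 1 := by
  have hb : IsBoundedUnder (· ≤ ·) atTop u := isBoundedUnder_of ⟨1, h1⟩
  have hc : IsCoboundedUnder (· ≤ ·) atTop u :=
    (isBoundedUnder_of ⟨0, h0⟩ : IsBoundedUnder (· ≥ ·) atTop u).isCoboundedUnder_le
  refine le_antisymm (limsup_le_of_le hc (Eventually.of_forall h1)) ?_
  refine le_of_forall_sub_le fun δ hδ => le_limsup_of_frequently_le (h δ hδ) hb

theorem liminf_eq_zero_of_frequently {u : ℕ → ℝ} (h0 : ∀ n, 0 ≤ u n) (h1 : ∀ n, u n ≤ 1)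
    (h : ∀ δ > 0, ∃ᶠ n in atTop, u n ≤ δ) : liminf u atTop = 0 := by
  have hb : IsBoundedUnder (· ≥ ·) atTop u := isBoundedUnder_of ⟨0, h0⟩
  have hc : IsCoboundedUnder (· ≥ ·) atTop u :=
    (isBoundedUnder_of ⟨1, h1⟩ : IsBoundedUnder (· ≤ ·) atTop u).isCoboundedUnder_ge
  refine le_antisymm ?_ (le_liminf_of_le hc (Eventually.of_forall h0))
  refine le_of_forall_pos_le_add fun δ hδ => ?_
  rw [zero_add]
  exact liminf_le_of_frequently_le (h δ hδ) hb

/-! ### Integer iterates of an automorphism -/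

section Iterates

variable {X : Type*} [MeasurableSpace X]

/-- The integer power `τ ^ k`, as a function. -/
def intIterate (τ : X ≃ᵐ X) (k : ℤ) (x : X) : X := (τ.toEquiv ^ k : Equiv.Perm X) x

theorem intIterate_zero (τ : X ≃ᵐ X) (x : X) : intIterate τ 0 x = x := rfl

theorem intIterate_one (τ : X ≃ᵐ X) (x : X) : intIterate τ 1 x = τ x := rfl

theorem intIterate_neg_one (τ : X ≃ᵐ X) (x : X) : intIterate τ (-1) x = τ.symm x := rfl

theorem intIterate_intIterate (τ : X ≃ᵐ X) (k l : ℤ) (x : X) :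
    intIterate τ k (intIterate τ l x) = intIterate τ (k + l) x := by
  simp [intIterate, zpow_add]

theorem measurePreserving_intIterate {m : Measure X} {τ : X ≃ᵐ X} (hτ : MeasurePreserving τ m m)
    (k : ℤ) : MeasurePreserving (intIterate τ k) m m := by
  induction k using Int.induction_on with
  | zero => exact MeasurePreserving.id m
  | succ k ih =>
    convert hτ.comp ih using 1
    ext x
    rw [Function.comp_apply, ← intIterate_one τ (intIterate τ k x), intIterate_intIterate, add_comm]
  | pred k ih =>
    convert (hτ.symm τ).comp ih using 1
    ext x
    rw [Function.comp_apply, ← intIterate_neg_one τ (intIterate τ _ x), intIterate_intIterate,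
      add_comm, sub_eq_add_neg]

theorem measure_intIterate_preimage {m : Measure X} {τ : X ≃ᵐ X} (hτ : MeasurePreserving τ m m)
    (k : ℤ) {A : Set X} (hA : MeasurableSet A) : m {x | intIterate τ k x ∈ A} = m A :=
  (measurePreserving_intIterate hτ k).measure_preimage hA.nullMeasurableSet

theorem measure_exists_intIterate_mem_le {m : Measure X} {τ : X ≃ᵐ X}
    (hτ : MeasurePreserving τ m m) (I : Finset ℤ) {A : Set X} (hA : MeasurableSet A) :
    m {x | ∃ k ∈ I, intIterate τ k x ∈ A} ≤ I.card * m A := by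
  have : {x | ∃ k ∈ I, intIterate τ k x ∈ A} = ⋃ k ∈ I, {x | intIterate τ k x ∈ A} := by
    ext; simp
  rw [this]
  refine (measure_biUnion_finset_le _ _).trans ?_
  simp [measure_intIterate_preimage hτ _ hA]

/-! ### Small sets and return times -/

theorem IsNonAtomic.exists_measure_le_half {m : Measure X} [IsFiniteMeasure m]
    (hm : IsNonAtomic m) {A : Set X} (hA : MeasurableSet A) (h0 : 0 < m A) :
    ∃ B, MeasurableSet B ∧ 0 < m B ∧ m B ≤ m A / 2 := by
  obtain ⟨B, hB, hBA, hpos, hlt⟩ := hm A hA h0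
  have hadd : m (A \ B) + m B = m A := by
    rw [measure_sdiff hBA hB.nullMeasurableSet (measure_ne_top _ _), tsub_add_cancel_of_le hlt.le]
  by_cases h : m B ≤ m A / 2
  · exact ⟨B, hB, hpos, h⟩
  · refine ⟨A \ B, hA.diff hB, ?_, ?_⟩
    · rw [measure_sdiff hBA hB.nullMeasurableSet (measure_ne_top _ _)]
      exact tsub_pos_of_lt hlt
    · by_contra h'
      have := ENNReal.add_lt_add (not_le.1 h') (not_le.1 h)
      rw [ENNReal.add_halves, hadd] at this
      exact lt_irrefl _ this

theorem IsNonAtomic.exists_measure_lt {m : Measure X} [IsProbabilityMeasure m]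
    (hm : IsNonAtomic m) {ε : ℝ≥0∞} (hε : ε ≠ 0) :
    ∃ B, MeasurableSet B ∧ 0 < m B ∧ m B < ε := by
  have key : ∀ n : ℕ, ∃ B, MeasurableSet B ∧ 0 < m B ∧ m B ≤ 2⁻¹ ^ n := by
    intro n
    induction n with
    | zero => exact ⟨univ, MeasurableSet.univ, by simp, by simp⟩
    | succ n ih =>
      obtain ⟨A, hA, h0, hle⟩ := ih
      obtain ⟨B, hB, hB0, hBle⟩ := hm.exists_measure_le_half hA h0
      refine ⟨B, hB, hB0, hBle.trans ?_⟩
      rw [pow_succ, ENNReal.div_eq_inv_mul, mul_comm]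
      gcongr
  obtain ⟨n, hn⟩ := ENNReal.exists_inv_two_pow_lt hε
  obtain ⟨B, hB, h0, hle⟩ := key n
  exact ⟨B, hB, h0, hle.trans_lt hn⟩

/-- The union of the forward images of `F` is mapped into itself by `τ`, so by ergodicity it is null
or full. -/
theorem ae_exists_intIterate_neg_mem {m : Measure X} [IsFiniteMeasure m] {τ : X ≃ᵐ X}
    (hτ : Ergodic τ m) {F : Set X} (hF : MeasurableSet F) (h0 : 0 < m F) :
    ∀ᵐ x ∂m, ∃ j : ℕ, intIterate τ (-j) x ∈ F := by
  set G : Set X := {x | ∃ j : ℕ, intIterate τ (-j) x ∈ F}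
  have hG : MeasurableSet G := by
    have : G = ⋃ j : ℕ, intIterate τ (-j) ⁻¹' F := by ext; simp [G]
    rw [this]
    exact MeasurableSet.iUnion fun j =>
      (measurePreserving_intIterate hτ.toMeasurePreserving _).measurable hF
  have hsub : G ⊆ τ ⁻¹' G := by
    rintro x ⟨j, hj⟩
    refine ⟨j + 1, ?_⟩
    rw [← intIterate_one τ x, intIterate_intIterate]
    convert hj using 2
    push_cast; ring
  have hFG : F ⊆ G := fun x hx => ⟨0, by simpa [intIterate_zero] using hx⟩
  rcases hτ.ae_empty_or_univ_of_ae_le_preimage hG.nullMeasurableSet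
    (LE.le.eventuallyLE hsub) with h | h
  · have := measure_mono_null hFG (ae_eq_empty.1 h)
    exact absurd this h0.ne'
  · filter_upwards [h] with x hx
    exact (eq_iff_iff.1 hx).2 trivial

/-- A function which, off a small set, is equivariant for all short time translations. -/
theorem exists_equivariant_on_window {m : Measure X} [IsProbabilityMeasure m]
    (hm : IsNonAtomic m) {τ : X ≃ᵐ X} (hτ : Ergodic τ m) (T : ℕ) {ε : ℝ≥0∞} (hε : ε ≠ 0) :
    ∃ r : X → ℕ, Measurable r ∧
      m {x | ¬ ∀ t : ℤ, |t| ≤ T → (r (intIterate τ t x) : ℤ) = r x + t} ≤ ε := by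
  classical
  set I : Finset ℤ := Finset.Icc (-(T : ℤ)) T
  have hI : (I.card : ℝ≥0∞) ≠ 0 := by
    have : I.card ≠ 0 := Finset.card_ne_zero_of_mem (a := 0) (by simp [I])
    exact_mod_cast this
  obtain ⟨F, hF, hF0, hFε⟩ := hm.exists_measure_lt (ε := ε / I.card)
    (ENNReal.div_ne_zero.2 ⟨hε, ENNReal.natCast_ne_top _⟩)
  set G : Set X := {x | ∃ j : ℕ, intIterate τ (-j) x ∈ F}
  have hmeas : ∀ j : ℕ, MeasurableSet {x | intIterate τ (-j) x ∈ F} := fun j =>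
    (measurePreserving_intIterate hτ.toMeasurePreserving _).measurable hF
  have hG : MeasurableSet G := by
    have : G = ⋃ j : ℕ, {x | intIterate τ (-j) x ∈ F} := by ext; simp [G]
    rw [this]
    exact MeasurableSet.iUnion hmeas
  -- The second alternative only makes `Nat.find` total, with value `0` on the null set off `G`.
  have hex : ∀ x, ∃ j : ℕ, intIterate τ (-j) x ∈ F ∨ x ∉ G := by
    intro x
    by_cases hx : x ∈ G
    · obtain ⟨j, hj⟩ := hx
      exact ⟨j, Or.inl hj⟩
    · exact ⟨0, Or.inr hx⟩
  refine ⟨fun x => Nat.find (hex x), measurable_find hex fun j => (hmeas j).union hG.compl, ?_⟩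
  have hGae : ∀ᵐ x ∂m, ∀ t : ℤ, intIterate τ t x ∈ G := by
    rw [ae_all_iff]
    intro t
    exact (measurePreserving_intIterate hτ.toMeasurePreserving t).quasiMeasurePreserving.ae
      (ae_exists_intIterate_neg_mem hτ hF hF0)
  have hle : m {x | ∃ k ∈ I, intIterate τ k x ∈ F} ≤ ε := by
    refine (measure_exists_intIterate_mem_le hτ.toMeasurePreserving I hF).trans ?_
    calc (I.card : ℝ≥0∞) * m F ≤ I.card * (ε / I.card) := by gcongr
      _ = ε := ENNReal.mul_div_cancel hI (ENNReal.natCast_ne_top _)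
  refine le_trans (measure_mono_ae ?_) hle
  filter_upwards [hGae] with x hxG
  intro hx
  by_contra hno
  refine hx fun t ht => ?_
  have hno' : ∀ k : ℤ, |k| ≤ T → intIterate τ k x ∉ F := fun k hk hkF =>
    hno ⟨k, Finset.mem_Icc.2 (abs_le.1 hk), hkF⟩
  have hfind : ∀ y, y ∈ G → intIterate τ (-(Nat.find (hex y) : ℤ)) y ∈ F := fun y hy =>
    (Nat.find_spec (hex y)).resolve_right (not_not.2 hy)
  have hmin : ∀ y (j : ℕ), intIterate τ (-j) y ∈ F → Nat.find (hex y) ≤ j := fun y j hj =>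
    Nat.find_min' (hex y) (Or.inl hj)
  have hx0 := hfind x (hxG 0)
  have hxt := hfind _ (hxG t)
  rw [intIterate_intIterate] at hxt
  -- With no visit to `F` at times in `[-T, T]`, the last visits seen from `x` and from its
  -- translate both precede the window. Each is thus a candidate for the other, and minimality gives
  -- both inequalities.
  have big : (T : ℤ) < Nat.find (hex x) := by
    by_contra! hlt
    exact hno' _ (by rw [abs_neg, abs_of_nonneg (by positivity)]; exact hlt) hx0
  have ht' := abs_le.1 ht
  have h1 : Nat.find (hex (intIterate τ t x)) ≤ ((Nat.find (hex x) : ℤ) + t).toNat := by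
    refine hmin _ _ ?_
    rw [intIterate_intIterate, Int.toNat_of_nonneg (by omega)]
    convert hx0 using 2
    ring
  have big' : (T : ℤ) < Nat.find (hex (intIterate τ t x)) - t := by
    by_contra! hlt
    exact hno' _ (abs_le.2 ⟨by omega, by omega⟩) hxt
  have h2 : Nat.find (hex x) ≤ ((Nat.find (hex (intIterate τ t x)) : ℤ) - t).toNat := by
    refine hmin _ _ ?_
    rw [Int.toNat_of_nonneg (by omega)]
    convert hxt using 2
    ring
  omega

end Iterates

/-! ### Sweeping out by small sets -/

section Sweeping

variable {X : Type*} [MeasurableSpace X]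

theorem sum_measure_fiber_union_succ {m : Measure X} [IsProbabilityMeasure m] {L : ℕ} [NeZero L]
    {g : X → ZMod L} (hg : ∀ k, MeasurableSet (g ⁻¹' {k})) :
    ∑ k, m (g ⁻¹' {k} ∪ g ⁻¹' {k + 1}) ≤ 2 := by
  have h1 : ∑ k, m (g ⁻¹' {k}) = 1 := by
    rw [sum_measure_preimage_singleton _ fun k _ => hg k]
    simp
  have h2 : ∑ k, m (g ⁻¹' {k + 1}) = 1 := by
    rw [← h1]
    exact Equiv.sum_comp (Equiv.addRight (1 : ZMod L)) fun k => m (g ⁻¹' {k})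
  calc _ ≤ ∑ k, (m (g ⁻¹' {k}) + m (g ⁻¹' {k + 1})) :=
        Finset.sum_le_sum fun k _ => measure_union_le _ _
    _ = 2 := by rw [Finset.sum_add_distrib, h1, h2, one_add_one_eq_two]

/-- Along a divergent sequence of times, most points visit a suitable set of small measure. -/
theorem exists_small_swept_set {m : Measure X} [IsProbabilityMeasure m]
    (hm : IsNonAtomic m) {τ : X ≃ᵐ X} (hτ : Ergodic τ m) {s : ℕ → ℤ}
    (hs : Tendsto s atTop atTop ∨ Tendsto s atTop atBot) (N : ℕ)
    {ε δ : ℝ≥0∞} (hε : ε ≠ 0) (hδ : δ ≠ 0) :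
    ∃ A : Set X, ∃ M : ℕ, MeasurableSet A ∧ m A ≤ ε ∧
      m {x | ¬ ∃ n, N ≤ n ∧ n ≤ M ∧ intIterate τ (s n) x ∈ A} ≤ δ := by
  -- The `L` pairs of adjacent colours have total measure at most `2 < L * ε`, so one pair has
  -- measure at most `ε`.
  obtain ⟨L, hL⟩ := ENNReal.exists_inv_nat_lt (ENNReal.half_pos hε).ne'
  have hL0 : L ≠ 0 := by
    rintro rfl
    simp at hL
  have : NeZero L := ⟨hL0⟩
  obtain ⟨f, hf⟩ := exists_colouring hs N (L := L)
  choose n hn hf using hf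
  set M := Finset.univ.sup n
  set T := Finset.univ.sup fun i => (s (n i)).natAbs
  obtain ⟨r, hr, hrm⟩ := exists_equivariant_on_window hm hτ T hδ
  set g : X → ZMod L := fun x => f (r x)
  have hg : ∀ k, MeasurableSet (g ⁻¹' {k}) := fun k =>
    hr (MeasurableSet.of_discrete (s := {j : ℕ | f j = k}))
  obtain ⟨k, hk⟩ : ∃ k, m (g ⁻¹' {k} ∪ g ⁻¹' {k + 1}) ≤ ε := by
    by_contra! hcon
    have h1 : ∑ _k : ZMod L, ε < ∑ k, m (g ⁻¹' {k} ∪ g ⁻¹' {k + 1}) :=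
      ENNReal.sum_lt_sum_of_nonempty Finset.univ_nonempty fun k _ => hcon k
    have h2 := h1.trans_le (sum_measure_fiber_union_succ hg)
    rw [Finset.sum_const, Finset.card_univ, ZMod.card, nsmul_eq_mul] at h2
    have h3 : (2 : ℝ≥0∞) ≤ L * ε := by
      have hLR : (L : ℝ≥0∞) ≠ 0 := by exact_mod_cast hL0
      calc (2 : ℝ≥0∞) = L * ((L : ℝ≥0∞)⁻¹ * 2) := by
            rw [← mul_assoc, ENNReal.mul_inv_cancel hLR (ENNReal.natCast_ne_top _), one_mul]
        _ ≤ L * (ε / 2 * 2) := by gcongr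
        _ = L * ε := by rw [ENNReal.div_mul_cancel two_ne_zero ENNReal.ofNat_ne_top]
    exact absurd h2 (not_lt.2 h3)
  refine ⟨_, M, (hg k).union (hg (k + 1)), hk, (measure_mono ?_).trans hrm⟩
  intro x hx hgood
  -- The advance that takes the colour of `x` to `k`, or to `k + 1` because of the error of one.
  set i := k - f (r x)
  refine hx ⟨n i, hn i, Finset.le_sup (f := n) (Finset.mem_univ i), ?_⟩
  have hle : (s (n i)).natAbs ≤ T :=
    Finset.le_sup (f := fun i => (s (n i)).natAbs) (Finset.mem_univ i)
  have h := hgood (s (n i)) (by rw [Int.abs_eq_natAbs]; exact_mod_cast hle)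
  have h' := hf i (r x)
  rw [← h, show f (r x) + i = k by simp [i]] at h'
  exact h'

theorem exists_small_swept_thickening {m : Measure X} [IsProbabilityMeasure m]
    (hm : IsNonAtomic m) {τ : X ≃ᵐ X} (hτ : Ergodic τ m) {s : ℕ → ℤ}
    (hs : Tendsto s atTop atTop ∨ Tendsto s atTop atBot) (K : ℕ)
    {ε δ : ℝ≥0∞} (hε : ε ≠ 0) (hδ : δ ≠ 0) :
    ∃ D : Set X, ∃ M : ℕ, MeasurableSet D ∧ m D ≤ ε ∧
      m {x | ¬ ∃ n, K ≤ n ∧ n ≤ M ∧ ∀ k ∈ Finset.Icc (-(K : ℤ)) K,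
        intIterate τ (s n + k) x ∈ D} ≤ δ := by
  set I : Finset ℤ := Finset.Icc (-(K : ℤ)) K
  have hI : (I.card : ℝ≥0∞) ≠ 0 := by
    have : I.card ≠ 0 := Finset.card_ne_zero_of_mem (a := 0) (by simp [I])
    exact_mod_cast this
  obtain ⟨A, M, hA, hAε, hAδ⟩ := exists_small_swept_set hm hτ hs K (ε := ε / I.card)
    (ENNReal.div_ne_zero.2 ⟨hε, ENNReal.natCast_ne_top _⟩) hδ
  refine ⟨{x | ∃ k ∈ I, intIterate τ k x ∈ A}, M, ?_, ?_, (measure_mono ?_).trans hAδ⟩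
  · have : {x | ∃ k ∈ I, intIterate τ k x ∈ A} = ⋃ k ∈ I, intIterate τ k ⁻¹' A := by ext; simp
    rw [this]
    exact I.measurableSet_biUnion fun k _ =>
      (measurePreserving_intIterate hτ.toMeasurePreserving k).measurable hA
  · refine (measure_exists_intIterate_mem_le hτ.toMeasurePreserving I hA).trans ?_
    calc (I.card : ℝ≥0∞) * m A ≤ I.card * (ε / I.card) := by gcongr
      _ = ε := ENNReal.mul_div_cancel hI (ENNReal.natCast_ne_top _)
  · rintro x hx ⟨n, hn, hnM, hxA⟩
    refine hx ⟨n, hn, hnM, fun k hk => ⟨-k, ?_, ?_⟩⟩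
    · simp only [I, Finset.mem_Icc] at hk ⊢
      omega
    · rw [intIterate_intIterate]
      convert hxA using 2
      ring

/-- Small sets `D K` such that almost every orbit is, for every large `K`, inside `D K` and outside
all later `D j` on a whole window of radius `K` around some `s n`. -/
theorem exists_swept_sequence {m : Measure X} [IsProbabilityMeasure m]
    (hm : IsNonAtomic m) {τ : X ≃ᵐ X} (hτ : Ergodic τ m) {s : ℕ → ℤ}
    (hs : Tendsto s atTop atTop ∨ Tendsto s atTop atBot) {ε : ℝ≥0∞} (hε : ε ≠ 0) :
    ∃ D : ℕ → Set X, (∀ K, MeasurableSet (D K)) ∧ m (⋃ K, D K) ≤ ε ∧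
      ∀ᵐ x ∂m, ∀ᶠ K : ℕ in atTop, ∃ n ≥ K, ∀ k ∈ Finset.Icc (-(K : ℤ)) K,
        intIterate τ (s n + k) x ∈ D K ∧ ∀ j > K, intIterate τ (s n + k) x ∉ D j := by
  have hpow : ∀ K : ℕ, ((2 : ℝ≥0∞)⁻¹ ^ K) ≠ 0 := fun K =>
    pow_ne_zero _ (ENNReal.inv_ne_zero.2 ENNReal.ofNat_ne_top)
  have stage : ∀ (K : ℕ) (η : {η : ℝ≥0∞ // η ≠ 0}), ∃ D : Set X, ∃ M : ℕ, MeasurableSet D ∧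
      m D ≤ η ∧ m {x | ¬ ∃ n, K ≤ n ∧ n ≤ M ∧ ∀ k ∈ Finset.Icc (-(K : ℤ)) K,
        intIterate τ (s n + k) x ∈ D} ≤ 2⁻¹ ^ K := fun K η =>
    exists_small_swept_thickening hm hτ hs K η.2 (hpow K)
  choose D M hD hDη hDM using stage
  set W : ℕ → ℕ → Finset ℤ := fun K M =>
    (Finset.range (M + 1) ×ˢ Finset.Icc (-(K : ℤ)) K).image fun p => s p.1 + p.2
  have hW : ∀ K M n : ℕ, n ≤ M → ∀ k ∈ Finset.Icc (-(K : ℤ)) K, s n + k ∈ W K M := fun K M n hn k hk =>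
    Finset.mem_image.2 ⟨(n, k), Finset.mem_product.2 ⟨Finset.mem_range.2 (by omega), hk⟩, rfl⟩
  -- `η K` bounds the measure of the `K`-th set. Once that set and its finite set `W` of relevant
  -- times are fixed, the next bound is taken so small that all later sets together are met during
  -- `W` with probability at most `2 * 2⁻¹ ^ K`. Halving makes the tails geometric.
  obtain ⟨η, hη0, hη⟩ : ∃ η : ℕ → {η : ℝ≥0∞ // η ≠ 0}, (η 0 : ℝ≥0∞) = ε / 2 ∧
      ∀ K, (η (K + 1) : ℝ≥0∞) = min ((η K : ℝ≥0∞) / 2)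
        ((2⁻¹ : ℝ≥0∞) ^ K / ((W K (M K (η K))).card : ℝ≥0∞)) := by
    have hstep : ∀ (K : ℕ) (e : {η : ℝ≥0∞ // η ≠ 0}), min ((e : ℝ≥0∞) / 2)
        ((2⁻¹ : ℝ≥0∞) ^ K / ((W K (M K e)).card : ℝ≥0∞)) ≠ 0 := fun K e =>
      (lt_min (ENNReal.half_pos e.2) (pos_iff_ne_zero.2
        (ENNReal.div_ne_zero.2 ⟨hpow K, ENNReal.natCast_ne_top _⟩))).ne'
    exact ⟨fun K => Nat.rec ⟨ε / 2, (ENNReal.half_pos hε).ne'⟩ (fun K e => ⟨_, hstep K e⟩) K,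
      rfl, fun K => rfl⟩
  have hdecay : ∀ K j, (η (K + j) : ℝ≥0∞) ≤ η K * 2⁻¹ ^ j := by
    intro K j
    induction j with
    | zero => simp
    | succ j ih =>
      rw [← add_assoc, hη]
      refine (min_le_left _ _).trans ?_
      rw [ENNReal.div_eq_inv_mul, pow_succ, ← mul_assoc, mul_comm]
      gcongr
  set E : ℕ → Set X := fun K => D K (η K)
  have hEm : ∀ K, MeasurableSet (E K) := fun K => hD K _
  have htail : ∀ K, m (⋃ j, E (K + j)) ≤ η K * 2 := fun K =>
    calc m (⋃ j, E (K + j)) ≤ ∑' j, m (E (K + j)) := measure_iUnion_le _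
      _ ≤ ∑' j, (η K : ℝ≥0∞) * 2⁻¹ ^ j := ENNReal.tsum_le_tsum fun j => (hDη _ _).trans (hdecay K j)
      _ = η K * 2 := by rw [ENNReal.tsum_mul_left, ENNReal.tsum_geometric_two]
  refine ⟨E, hEm, ?_, ?_⟩
  · have := htail 0
    simp only [zero_add, hη0] at this
    rwa [ENNReal.div_mul_cancel two_ne_zero ENNReal.ofNat_ne_top] at this
  set bad₁ : ℕ → Set X := fun K => {x | ¬ ∃ n, K ≤ n ∧ n ≤ M K (η K) ∧
    ∀ k ∈ Finset.Icc (-(K : ℤ)) K, intIterate τ (s n + k) x ∈ E K}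
  set bad₂ : ℕ → Set X := fun K =>
    {x | ∃ k ∈ W K (M K (η K)), intIterate τ k x ∈ ⋃ j, E (K + 1 + j)}
  have hbad₁ : ∀ K, m (bad₁ K) ≤ 2⁻¹ ^ K := fun K => hDM K _
  have hbad₂ : ∀ K, m (bad₂ K) ≤ 2⁻¹ ^ K * 2 := by
    intro K
    refine (measure_exists_intIterate_mem_le hτ.toMeasurePreserving _
      (MeasurableSet.iUnion fun j => hEm _)).trans ?_
    calc ((W K (M K (η K))).card : ℝ≥0∞) * m (⋃ j, E (K + 1 + j))
        ≤ (W K (M K (η K))).card * (2⁻¹ ^ K / (W K (M K (η K))).card * 2) := by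
          gcongr
          refine (htail (K + 1)).trans ?_
          rw [hη]
          gcongr
          exact min_le_right _ _
      _ = (W K (M K (η K))).card * (2⁻¹ ^ K / (W K (M K (η K))).card) * 2 := by rw [mul_assoc]
      _ ≤ 2⁻¹ ^ K * 2 := by
          gcongr
          exact ENNReal.mul_div_le
  have hsum : ∑' K, m (bad₁ K ∪ bad₂ K) ≠ ⊤ := by
    refine ne_top_of_le_ne_top (b := ∑' K : ℕ, (2 : ℝ≥0∞)⁻¹ ^ K * 3) ?_
      (ENNReal.tsum_le_tsum fun K => ?_)
    · rw [ENNReal.tsum_mul_right, ENNReal.tsum_geometric_two]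
      exact ENNReal.mul_ne_top ENNReal.ofNat_ne_top ENNReal.ofNat_ne_top
    · calc m (bad₁ K ∪ bad₂ K) ≤ 2⁻¹ ^ K + 2⁻¹ ^ K * 2 :=
            (measure_union_le _ _).trans (add_le_add (hbad₁ K) (hbad₂ K))
        _ = 2⁻¹ ^ K * 3 := by ring
  filter_upwards [ae_eventually_notMem hsum] with x hx
  filter_upwards [hx] with K hK
  rw [mem_union, not_or] at hK
  obtain ⟨n, hn, hnM, hmem⟩ := not_not.1 hK.1
  refine ⟨n, hn, fun k hk => ⟨hmem k hk, fun j hj hmemj => hK.2 ⟨s n + k, hW _ _ n hnM k hk, ?_⟩⟩⟩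
  refine mem_iUnion.2 ⟨j - (K + 1), ?_⟩
  rwa [Nat.add_sub_of_le (show K + 1 ≤ j from hj)]

/-- A set of small measure such that almost every orbit contains arbitrarily long windows around
terms of `s` inside the set, and arbitrarily long ones outside it. -/
theorem exists_small_set_windows {m : Measure X} [IsProbabilityMeasure m]
    (hm : IsNonAtomic m) {τ : X ≃ᵐ X} (hτ : Ergodic τ m) {s : ℕ → ℤ}
    (hs : Tendsto s atTop atTop ∨ Tendsto s atTop atBot) {ε : ℝ≥0∞} (hε : ε ≠ 0) :
    ∃ B : Set X, MeasurableSet B ∧ m B ≤ ε ∧ ∀ᵐ x ∂m,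
      (∀ K : ℕ, ∃ n ≥ K, ∀ k : ℤ, |k - s n| ≤ K → intIterate τ k x ∈ B) ∧
      (∀ K : ℕ, ∃ n ≥ K, ∀ k : ℤ, |k - s n| ≤ K → intIterate τ k x ∉ B) := by
  obtain ⟨D, hD, hDε, hae⟩ := exists_swept_sequence hm hτ hs hε
  -- These are the points for which the last `D j` containing them exists and has even index.
  -- Windows of even stages lie inside, those of odd stages outside.
  refine ⟨⋃ i, D (2 * i) \ ⋃ j > 2 * i, D j, ?_, (measure_mono ?_).trans hDε, ?_⟩
  · exact MeasurableSet.iUnion fun i => (hD _).diff <|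
      MeasurableSet.biUnion (to_countable _) fun j _ => hD j
  · exact iUnion_subset fun i => sdiff_subset.trans (subset_iUnion D (2 * i))
  filter_upwards [hae] with x hx
  obtain ⟨K₀, hK₀⟩ := eventually_atTop.1 hx
  refine ⟨fun K => ?_, fun K => ?_⟩
  · obtain ⟨n, hn, h⟩ := hK₀ (2 * (K + K₀)) (by omega)
    refine ⟨n, by omega, fun k hk => ?_⟩
    obtain ⟨h1, h2⟩ := h (k - s n) (Finset.mem_Icc.2 (abs_le.1 (hk.trans (by push_cast; omega))))
    rw [add_sub_cancel] at h1 h2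
    refine mem_iUnion.2 ⟨K + K₀, h1, ?_⟩
    simpa using h2
  · obtain ⟨n, hn, h⟩ := hK₀ (2 * (K + K₀) + 1) (by omega)
    refine ⟨n, by omega, fun k hk hmem => ?_⟩
    obtain ⟨h1, h2⟩ := h (k - s n) (Finset.mem_Icc.2 (abs_le.1 (hk.trans (by push_cast; omega))))
    rw [add_sub_cancel] at h1 h2
    obtain ⟨i, hi, hi'⟩ := mem_iUnion.1 hmem
    have hi'' : ∀ j > 2 * i, intIterate τ k x ∉ D j := by simpa using hi'
    rcases lt_or_ge (2 * i) (2 * (K + K₀) + 1) with hlt | hge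
    · exact hi'' _ hlt h1
    · exact h2 (2 * i) (by omega) hi

end Sweeping

theorem corollary4p2p2
    (a : ℕ → ℝ) (x : ℕ → ℤ) (γ ν : ℕ → Measure ℤ)
    (ha : ∀ n, 0 ≤ a n ∧ a n ≤ 1)
    (hγ : ∀ n, IsProbabilityMeasure (γ n))
    (hν : ∀ n, ν n =
      ENNReal.ofReal (a n) • Measure.dirac (x n) + ENNReal.ofReal (1 - a n) • γ n)
    (hsum : Summable fun n => 1 - a n)
    (hx : ∀ n, 1 ≤ |x n|)
    (hdiv : Tendsto (fun N : ℕ => ∑ n ∈ Finset.range N, x n) atTop atTop ∨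
      Tendsto (fun N : ℕ => ∑ n ∈ Finset.range N, x n) atTop atBot)
    {X : Type*} [MeasurableSpace X] (m : Measure X) [IsProbabilityMeasure m]
    (hm : IsNonAtomic m) (τ : X ≃ᵐ X) (hτ : Ergodic τ m) :
    StrongSweepingOut m τ (convProd ν) := by
  intro ε hε
  have hprob : ∀ n, IsProbabilityMeasure (ν n) := fun n => ⟨by
    have := hγ n
    rw [hν n]
    simp only [Measure.coe_add, Measure.coe_smul, Pi.add_apply, Pi.smul_apply, measure_univ,
      smul_eq_mul, mul_one]
    rw [← ENNReal.ofReal_add (ha n).1 (sub_nonneg.2 (ha n).2)]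
    simp⟩
  have hmass : ∀ n, a n ≤ (ν n).real {x n} := by
    intro n
    have h : ENNReal.ofReal (a n) ≤ ν n {x n} := by
      rw [hν n]
      simp
    have := hprob n
    exact (ENNReal.ofReal_le_iff_le_toReal (measure_ne_top _ _)).1 h
  have hconv := isProbabilityMeasure_convProd hprob
  set s : ℕ → ℤ := fun n => ∑ i ∈ Finset.range (n + 1), x i
  have hs : Tendsto s atTop atTop ∨ Tendsto s atTop atBot :=
    hdiv.imp (fun h => h.comp (tendsto_add_atTop_nat 1)) fun h => h.comp (tendsto_add_atTop_nat 1)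
  obtain ⟨B, hB, hBε, hae⟩ := exists_small_set_windows hm hτ hs (ε := ENNReal.ofReal (ε / 2))
    (by simpa using half_pos hε)
  refine ⟨B, hB, hBε.trans_lt ((ENNReal.ofReal_lt_ofReal_iff hε).2 (half_lt_self hε)), ?_, ?_⟩
  · filter_upwards [hae] with y hy
    simp_rw [weightedAverage_indicator]
    refine limsup_eq_one_of_frequently (fun n => measureReal_nonneg)
      (fun n => measureReal_le_one) fun δ hδ => frequently_atTop.2 fun N => ?_
    obtain ⟨K, N', hK⟩ := exists_convProd_concentration hprob (fun n => (ha n).2) hmass hsum hδ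
    -- The sum serves three bounds: window radius at least `K`, `n ≥ N` for frequency, and `n ≥ N'`
    -- for concentration.
    obtain ⟨n, hn, h⟩ := hy.1 (K + N + N')
    refine ⟨n, by omega, (hK n (by omega)).trans (measureReal_mono fun k hk => h k ?_)⟩
    exact le_trans (show |k - s n| ≤ K from hk) (by push_cast; omega)
  · filter_upwards [hae] with y hy
    simp_rw [weightedAverage_indicator]
    refine liminf_eq_zero_of_frequently (fun n => measureReal_nonneg)
      (fun n => measureReal_le_one) fun δ hδ => frequently_atTop.2 fun N => ?_
    obtain ⟨K, N', hK⟩ := exists_convProd_concentration hprob (fun n => (ha n).2) hmass hsum hδ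
    obtain ⟨n, hn, h⟩ := hy.2 (K + N + N')
    refine ⟨n, by omega, ?_⟩
    set S : Set ℤ := {k | |k - s n| ≤ K}
    have h1 : 1 - δ ≤ (convProd ν n).real S := hK n (by omega)
    have h2 : (convProd ν n).real {k : ℤ | (τ.toEquiv ^ k : Equiv.Perm X) y ∈ B} ≤
        (convProd ν n).real Sᶜ := measureReal_mono fun k hk hkS =>
      h k (le_trans (show |k - s n| ≤ K from hkS) (by push_cast; omega)) hk
    rw [measureReal_compl S.to_countable.measurableSet, probReal_univ] at h2
    linarith
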